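/- Let $m\ge 2$ and $k\ge 2$ be integers and let $\mathcal A_m=\{0,\dots,m-1\}$, identified with $\mathbb Z/m\mathbb Z$. Let $\sigma_m:\mathcal A_m^*\to\mathcal A_m^*$ be the morphism $\sigma_m(i)=i\,(i+1)\cdots(i+m-1)$ (letters modulo $m$), and let $\mathbf t_m=\lim_{j\to\infty}\sigma_m^j(0)$ be the generalized Thue--Morse word. A factor of $\mathbf t_m$ is a finite block of consecutive letters of $\mathbf t_m$. For words $u,w$ let $\binom uw$ be the number of occurrences of $w$ as a (scattered) subword of $u$; write $u\sim_k v$ if $\binom ux=\binom vx$ for all words $x$ with $|x|\le k$. For pairs of words of length less than $m^k$, write $(p_1,s_1)\equiv_k(p_2,s_2)$ if there are words $x,y,p,q,r,t\in\mathcal A_m^*$ with $|x|,|y|<m^{k-1}$ such that \[(p_1,s_1)=\bigl(x\,\sigma_m^{k-1}(p),\ \sigma_m^{k-1}(q)\,y\bigr),\qquad (p_2,s_2)=\bigl(x\,\sigma_m^{k-1}(r),\ \sigma_m^{k-1}(t)\,y\bigr),\] and $pq\sim_1 rt$, or $pq\sim_1 rt\,\sigma_m(0)$, or $pq\,\sigma_m(0)\sim_1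 rt$. A $\sigma_m^k$-factorization of a factor $U$ is a factorization $U=P\,\sigma_m^k(u)\,S$ for which there are $a,b\in\mathcal A_m\cup\{\varepsilon\}$ such that $aub$ is a factor of $\mathbf t_m$, $P$ is a proper suffix of $\sigma_m^k(a)$ and $S$ is a proper prefix of $\sigma_m^k(b)$ (where $\varepsilon$ counts as a proper prefix and suffix of itself). Let $U$ and $V$ be factors of $\mathbf t_m$ with the same length $|U|=|V|\ge 2m^k$. (1) Suppose that \[U=p_U\,\sigma_m^{k-1}\bigl(\alpha_u\,\sigma_m(u)\,\beta_u\bigr)\,s_U,\qquad V=p_V\,\sigma_m^{k-1}\bigl(\alpha_v\,\sigma_m(v)\,\beta_v\bigr)\,s_V\] with $|p_U|,|s_U|,|p_V|,|s_V|<m^{k-1}$ and $|\alpha_u|,|\beta_u|,|\alpha_v|,|\beta_v|<m$. If $U\sim_k V$, then \[\bigl(p_U\,\sigma_m^{k-1}(\alpha_u),\ \sigma_m^{k-1}(\beta_u)\,s_U\bigr)\equiv_k\bigl(p_V\,\sigma_m^{k-1}(\alpha_v),\ \sigma_m^{k-1}(\beta_v)\,s_V\bigr).\] (2) Consequently, if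 $U=P_U\,\sigma_m^k(u)\,S_U$ and $V=P_V\,\sigma_m^k(v)\,S_V$ are $\sigma_m^k$-factorizations, then $U\sim_k V$ if and only if $(P_U,S_U)\equiv_k(P_V,S_V)$. -/

import Mathlib

namespace ThueMorse

/-- The morphism `σ_m : i ↦ i (i+1) ⋯ (i+m-1)` on finite words over `ℤ/mℤ`. -/
def sigma (m : ℕ) (w : List (ZMod m)) : List (ZMod m) :=
  w.flatMap fun i => (List.range m).map fun j : ℕ => i + (j : ZMod m)

/-- The iterate `σ_m^j`. -/
def sigmaPow (m j : ℕ) (w : List (ZMod m)) : List (ZMod m) :=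
  (sigma m)^[j] w

/-- The infinite word `t_m = lim_j σ_m^j(0)`. For `m ≥ 2` its `n`-th letter can be read off
`σ_m^n(0)`, which has length `m^n > n`; see `getElem?_sigmaPow_zero`. -/
def word (m n : ℕ) : ZMod m :=
  (sigmaPow m n [0]).getD n 0

theorem length_sigma (m : ℕ) (w : List (ZMod m)) : (sigma m w).length = m * w.length := by
  induction w with
  | nil => simp [sigma]
  | cons a w ih =>
    simp only [sigma, List.flatMap_cons, List.length_append, List.length_map, List.length_range,
      List.length_cons] at ih ⊢
    rw [ih]; ring

theorem length_sigmaPow (m j : ℕ) (w : List (ZMod m)) :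
    (sigmaPow m j w).length = m ^ j * w.length := by
  induction j with
  | zero => simp [sigmaPow]
  | succ j ih =>
    have h : sigmaPow m (j + 1) w = sigma m (sigmaPow m j w) :=
      Function.iterate_succ_apply' _ _ _
    rw [h, length_sigma, ih]; ring

theorem sigmaPow_zero_prefix {m : ℕ} (hm : 2 ≤ m) {i j : ℕ} (hij : i ≤ j) :
    sigmaPow m i [0] <+: sigmaPow m j [0] := by
  have hs : ∀ {u v : List (ZMod m)}, u <+: v → sigma m u <+: sigma m v := by
    rintro u v ⟨r, rfl⟩
    exact ⟨sigma m r, by simp [sigma]⟩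
  have step : ∀ i, sigmaPow m i [0] <+: sigmaPow m (i + 1) [0] := by
    intro i
    induction i with
    | zero =>
      obtain ⟨n, rfl⟩ : ∃ n, m = n + 1 := ⟨m - 1, by omega⟩
      simp [sigmaPow, sigma, List.range_succ_eq_map]
    | succ i ih =>
      have h : ∀ l, sigmaPow m (l + 1) [0] = sigma m (sigmaPow m l [0]) :=
        fun l => Function.iterate_succ_apply' _ _ _
      rw [h (i + 1)]
      nth_rewrite 1 [h i]
      exact hs ih
  induction j, hij using Nat.le_induction with
  | base => exact List.prefix_rfl
  | succ j _ ih => exact ih.trans (step j)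

/-- `t_m` is the limit of the words `σ_m^j(0)`: each of them is a prefix of `t_m`. -/
theorem getElem?_sigmaPow_zero {m : ℕ} (hm : 2 ≤ m) {j n : ℕ} (hn : n < m ^ j) :
    (sigmaPow m j [0])[n]? = some (word m n) := by
  have hj : n < (sigmaPow m j [0]).length := by simpa [length_sigmaPow] using hn
  have hn' : n < (sigmaPow m n [0]).length := by
    simpa [length_sigmaPow] using Nat.lt_pow_self (by omega)
  have hw : word m n = (sigmaPow m n [0])[n] := by
    simp [word, List.getD_eq_getElem?_getD, List.getElem?_eq_getElem hn']
  rw [hw, List.getElem?_eq_getElem hj]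
  rcases le_total j n with h | h
  · rw [(sigmaPow_zero_prefix hm h).getElem hj]
  · rw [(sigmaPow_zero_prefix hm h).getElem hn']

/-- `U` is a factor of `t_m`: it occurs as a block of consecutive letters of `t_m`. -/
def IsFactor (m : ℕ) (U : List (ZMod m)) : Prop :=
  ∃ i : ℕ, U = (List.range U.length).map fun j : ℕ => word m (i + j)

/-- The binomial coefficient of words: the number of occurrences of `w` as a subword of `u`.
`List.sublists'` lists the subwords of `u` with multiplicity, one entry for each set of
positions. -/
def binom {m : ℕ} (u w : List (ZMod m)) : ℕ :=
  u.sublists'.count w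

/-- `k`-binomial equivalence `u ∼_k v`. -/
def BinomEq {m : ℕ} (k : ℕ) (u v : List (ZMod m)) : Prop :=
  ∀ x : List (ZMod m), x.length ≤ k → binom u x = binom v x

/-- The relation `(p₁, s₁) ≡_k (p₂, s₂)` on pairs of words of length less than `m^k`. -/
def PairEq (m k : ℕ) (P₁ P₂ : List (ZMod m) × List (ZMod m)) : Prop :=
  (P₁.1.length < m ^ k ∧ P₁.2.length < m ^ k) ∧
  (P₂.1.length < m ^ k ∧ P₂.2.length < m ^ k) ∧
  ∃ x y p q r t : List (ZMod m),
    x.length < m ^ (k - 1) ∧ y.length < m ^ (k - 1) ∧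
    P₁ = (x ++ sigmaPow m (k - 1) p, sigmaPow m (k - 1) q ++ y) ∧
    P₂ = (x ++ sigmaPow m (k - 1) r, sigmaPow m (k - 1) t ++ y) ∧
    (BinomEq 1 (p ++ q) (r ++ t) ∨
      BinomEq 1 (p ++ q) (r ++ t ++ sigma m [0]) ∨
      BinomEq 1 (p ++ q ++ sigma m [0]) (r ++ t))

/-- `U = x σ_m^j(u) y` is a `σ_m^j`-factorization: some `a u b` is a factor of `t_m`, where each
of `a`, `b` is a letter or empty, `x` is a proper suffix of `σ_m^j(a)` and `y` is a proper prefix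
of `σ_m^j(b)`. The empty word counts as a proper prefix and suffix of itself. -/
def IsFactorization (m j : ℕ) (U x u y : List (ZMod m)) : Prop :=
  U = x ++ sigmaPow m j u ++ y ∧
  ∃ a b : List (ZMod m), a.length ≤ 1 ∧ b.length ≤ 1 ∧ IsFactor m (a ++ u ++ b) ∧
    (x <:+ sigmaPow m j a ∧ (x = sigmaPow m j a → x = [])) ∧
    (y <+: sigmaPow m j b ∧ (y = sigmaPow m j b → y = []))

end ThueMorse

namespace ThueMorse

/-! Write `k = j + 1`. Everything reduces to comparing middle words `W = α σ_m(u) β`, since for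
words of equal length with short ends the three alternatives of `≡_k` say that the middles are
abelian equivalent (`perm_ends_iff`).

From `≡_k` to `∼_k`: `σ_m^j` turns abelian equivalence into `(j+1)`-binomial equivalence, because
commuting two equivalent words gains one order (`BinomEq.append_comm`).

From `∼_k` to `≡_k`: by induction on `j`, `∼_{j+1}` forces equal ends `p`, `s` and abelian
equivalent middles (`parse_eq_of_binomEq`). In the inductive step the lower order handles the cut
along `σ_m^j`; cancelling the common ends leaves `σ_m^j(W) ∼_{j+2} σ_m^j(W')` with `W`, `W'` abelian
equivalent. Binomial coefficients determine power sums of letter positions. For weights on letters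
with zero sum, each `σ_m` lowers the degree by one, so the sums of degree `j + 1` descend to sums of
degree 1 on `W` and `W'` (`BinomEq.tailSum_eq`). With weight `f c - f (c + 1)` these telescope along
runs of consecutive letters, and indicator functions `f` then recover how `W` is cut into blocks
(`parse_eq`). The last step needs a desubstituted word that is not a power of a letter, which holds
as `t_m` has no letter cube. -/

theorem binom_nil_right {m : ℕ} (u : List (ZMod m)) : binom u [] = 1 := by
  induction u with
  | nil => simp [binom]
  | cons c u ih =>
    simp only [binom, List.sublists'_cons, List.count_append] at ih ⊢
    rw [ih, List.count_eq_zero.2 (by simp)]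

theorem binom_nil_cons {m : ℕ} (a : ZMod m) (x : List (ZMod m)) : binom [] (a :: x) = 0 := by
  simp [binom]

theorem binom_cons_cons {m : ℕ} (c : ZMod m) (u : List (ZMod m)) (a : ZMod m)
    (x : List (ZMod m)) :
    binom (c :: u) (a :: x) = binom u (a :: x) + if c = a then binom u x else 0 := by
  simp only [binom, List.sublists'_cons, List.count_append]
  congr 1
  split_ifs with h
  · subst h
    exact List.count_map_of_injective _ _ List.cons_injective _
  · exact List.count_eq_zero.2 (by simp [h])

/-- The binomial coefficients of a concatenation, as a sum over the splittings of the subword. -/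
theorem binom_append {m : ℕ} (u v x : List (ZMod m)) :
    binom (u ++ v) x =
      ∑ i ∈ Finset.range (x.length + 1), binom u (x.take i) * binom v (x.drop i) := by
  induction u generalizing x with
  | nil =>
    rw [Finset.sum_range_succ']
    cases x with
    | nil => simp [binom_nil_right]
    | cons a x => simp [binom_nil_right, binom_nil_cons]
  | cons c u ih =>
    cases x with
    | nil => simp [binom_nil_right]
    | cons a x =>
      rw [List.cons_append, binom_cons_cons, ih, ih, Finset.sum_range_succ',
        Finset.sum_range_succ' _ (List.length (a :: x))]
      simp only [List.take_succ_cons, List.drop_succ_cons, binom_cons_cons, List.take_zero,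
        List.drop_zero, binom_nil_right, add_mul, Finset.sum_add_distrib, List.length_cons]
      split_ifs
      · ring
      · simp

theorem binomEq_one_iff {m : ℕ} {u v : List (ZMod m)} : BinomEq 1 u v ↔ u.Perm v := by
  have h : ∀ (u : List (ZMod m)) a, binom u [a] = u.count a := by
    intro u a
    induction u with
    | nil => simp [binom_nil_cons]
    | cons c u ih => rw [binom_cons_cons, ih, binom_nil_right, List.count_cons]; simp
  rw [List.perm_iff_count]
  constructor
  · intro H a
    rw [← h, ← h]
    exact H [a] (by simp)
  · intro H x hx
    match x, hx with
    | [], _ => simp [binom_nil_right]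
    | [a], _ => rw [h, h, H]

/-! ### Binomial equivalence as a cancellative congruence -/

namespace BinomEq

variable {m k : ℕ} {u v w u' v' : List (ZMod m)}

theorem trans (h : BinomEq k u v) (h' : BinomEq k v w) : BinomEq k u w :=
  fun x hx => (h x hx).trans (h' x hx)

theorem mono {l : ℕ} (h : BinomEq k u v) (hl : l ≤ k) : BinomEq l u v :=
  fun x hx => h x (hx.trans hl)

theorem append (h : BinomEq k u v) (h' : BinomEq k u' v') : BinomEq k (u ++ u') (v ++ v') := by
  intro x hx
  rw [binom_append, binom_append]
  refine Finset.sum_congr rfl fun i _ => ?_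
  rw [h _ (by simp; omega), h' _ (by simp; omega)]

/-- In the splitting formula the term with empty left part is `binom u x` itself; all others involve
`u` only through shorter words, so induct on the length of `x`. -/
theorem append_left_cancel (h : BinomEq k (w ++ u) (w ++ v)) : BinomEq k u v := by
  intro x
  induction hn : x.length using Nat.strong_induction_on generalizing x with
  | _ n ih =>
    intro hx
    have H := h x (by omega)
    rw [binom_append, binom_append, Finset.sum_range_succ', Finset.sum_range_succ' _ x.length] at H
    have : ∑ i ∈ Finset.range x.length, binom w (x.take (i + 1)) * binom u (x.drop (i + 1)) =
        ∑ i ∈ Finset.range x.length, binom w (x.take (i + 1)) * binom v (x.drop (i + 1)) := by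
      refine Finset.sum_congr rfl fun i hi => ?_
      rw [Finset.mem_range] at hi
      rw [ih (n - (i + 1)) (by omega) _ (by simp [hn]) (by omega)]
    rw [this] at H
    simpa [binom_nil_right] using H

theorem append_right_cancel (h : BinomEq k (u ++ w) (v ++ w)) : BinomEq k u v := by
  intro x
  induction hn : x.length using Nat.strong_induction_on generalizing x with
  | _ n ih =>
    intro hx
    have H := h x (by omega)
    rw [binom_append, binom_append, Finset.sum_range_succ, Finset.sum_range_succ _ x.length] at H
    have : ∑ i ∈ Finset.range x.length, binom u (x.take i) * binom w (x.drop i) =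
        ∑ i ∈ Finset.range x.length, binom v (x.take i) * binom w (x.drop i) := by
      refine Finset.sum_congr rfl fun i hi => ?_
      rw [Finset.mem_range] at hi
      rw [ih i (by omega) _ (by simp; omega) (by omega)]
    rw [this] at H
    simpa [binom_nil_right] using H

/-- `k`-binomially equivalent words commute up to `(k+1)`-binomial equivalence. -/
theorem append_comm (h : BinomEq k u v) : BinomEq (k + 1) (u ++ v) (v ++ u) := by
  intro x hx
  rw [binom_append, binom_append]
  rcases hn : x.length with _ | n
  · rw [List.length_eq_zero_iff] at hn
    simp [hn, binom_nil_right]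
  · rw [Finset.sum_range_succ, Finset.sum_range_succ', Finset.sum_range_succ _ (n + 1),
      Finset.sum_range_succ' _ n]
    have : ∑ i ∈ Finset.range n, binom u (x.take (i + 1)) * binom v (x.drop (i + 1)) =
        ∑ i ∈ Finset.range n, binom v (x.take (i + 1)) * binom u (x.drop (i + 1)) := by
      refine Finset.sum_congr rfl fun i hi => ?_
      rw [Finset.mem_range] at hi
      rw [h _ (by simp; omega), h (x.drop (i + 1)) (by simp; omega)]
    rw [this, ← hn]
    simp [binom_nil_right]
    ring

end BinomEq

/-! ### Runs, the iterates of `σ_m`, and the gain of order -/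

/-- A run of `q` consecutive letters starting with `c`. -/
def run (m : ℕ) (c : ZMod m) (q : ℕ) : List (ZMod m) :=
  (List.range q).map fun j : ℕ => c + (j : ZMod m)

@[simp] theorem length_run (m : ℕ) (c : ZMod m) (q : ℕ) : (run m c q).length = q := by simp [run]

theorem run_succ (m : ℕ) (c : ZMod m) (q : ℕ) : run m c (q + 1) = c :: run m (c + 1) q := by
  rw [run, run, List.range_succ_eq_map, List.map_cons, List.map_map]
  simp only [Function.comp_def, Nat.cast_zero, add_zero, Nat.cast_succ]
  congr 2
  ext1 j
  ring

@[simp] theorem sigma_nil (m : ℕ) : sigma m [] = [] := rfl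

theorem sigma_cons (m : ℕ) (c : ZMod m) (w : List (ZMod m)) :
    sigma m (c :: w) = run m c m ++ sigma m w := by simp [sigma, run]

theorem sigma_append (m : ℕ) (u v : List (ZMod m)) : sigma m (u ++ v) = sigma m u ++ sigma m v := by
  simp [sigma]

theorem sigmaPow_succ (m j : ℕ) (w : List (ZMod m)) :
    sigmaPow m (j + 1) w = sigma m (sigmaPow m j w) := Function.iterate_succ_apply' _ _ _

theorem sigmaPow_succ' (m j : ℕ) (w : List (ZMod m)) :
    sigmaPow m (j + 1) w = sigmaPow m j (sigma m w) := Function.iterate_succ_apply _ _ _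

theorem sigmaPow_append (m j : ℕ) (u v : List (ZMod m)) :
    sigmaPow m j (u ++ v) = sigmaPow m j u ++ sigmaPow m j v := by
  induction j with
  | zero => rfl
  | succ j ih => rw [sigmaPow_succ, ih, sigma_append, ← sigmaPow_succ, ← sigmaPow_succ]

theorem count_run {m : ℕ} (hm : 0 < m) (c a : ZMod m) : (run m c m).count a = 1 := by
  have : NeZero m := ⟨hm.ne'⟩
  refine List.count_eq_one_of_mem ?_ ?_
  · refine List.Nodup.map_on ?_ List.nodup_range
    intro i hi j hj h
    rw [List.mem_range] at hi hj
    have h' := (ZMod.natCast_eq_natCast_iff' i j m).1 (add_left_cancel h)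
    rwa [Nat.mod_eq_of_lt hi, Nat.mod_eq_of_lt hj] at h'
  · refine List.mem_map.2 ⟨(a - c).val, List.mem_range.2 (ZMod.val_lt _), ?_⟩
    simp

theorem count_sigma {m : ℕ} (hm : 0 < m) (w : List (ZMod m)) (a : ZMod m) :
    (sigma m w).count a = w.length := by
  induction w with
  | nil => simp
  | cons c w ih => rw [sigma_cons, List.count_append, count_run hm, ih, List.length_cons, add_comm]

/-- The iterate `σ_m^j` sends abelian equivalence to `(j+1)`-binomial equivalence. -/
theorem _root_.List.Perm.binomEq_sigmaPow {m : ℕ} (hm : 0 < m) (j : ℕ) {u v : List (ZMod m)}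
    (h : u.Perm v) : BinomEq (j + 1) (sigmaPow m j u) (sigmaPow m j v) := by
  induction j generalizing u v with
  | zero => exact binomEq_one_iff.2 h
  | succ j ihj =>
    induction h with
    | nil => exact fun _ _ => rfl
    | @cons a l₁ l₂ _ ih =>
      have e : ∀ l : List (ZMod m),
          sigmaPow m (j + 1) (a :: l) = sigmaPow m (j + 1) [a] ++ sigmaPow m (j + 1) l :=
        fun l => sigmaPow_append m (j + 1) [a] l
      rw [e l₁, e l₂]
      exact BinomEq.append (fun _ _ => rfl) ih
    | swap a b l =>
      have e : ∀ c d : ZMod m, c :: d :: l = [c] ++ [d] ++ l := fun _ _ => rfl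
      rw [e, e, sigmaPow_append, sigmaPow_append, sigmaPow_append _ _ _ l, sigmaPow_append]
      refine BinomEq.append (BinomEq.append_comm ?_) fun _ _ => rfl
      -- `σ_m(a)` and `σ_m(b)` contain every letter once, so the outer induction applies to them,
      -- and `append_comm` supplies the extra order.
      rw [sigmaPow_succ', sigmaPow_succ']
      refine ihj (List.perm_iff_count.2 fun c => ?_)
      rw [count_sigma hm, count_sigma hm]; rfl
    | trans _ _ ih₁ ih₂ => exact ih₁.trans ih₂

/-! ### Weighted position sums -/

/-- The sum over the letters `c` of a word of `g c x`, where `x` is the number of letters after `c`. -/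
def tailSum {m : ℕ} (g : ZMod m → ℕ → ℤ) : List (ZMod m) → ℤ
  | [] => 0
  | c :: u => g c u.length + tailSum g u

section tailSum

variable {m : ℕ}

theorem tailSum_append (g : ZMod m → ℕ → ℤ) (u v : List (ZMod m)) :
    tailSum g (u ++ v) = tailSum (fun c x => g c (x + v.length)) u + tailSum g v := by
  induction u with
  | nil => simp [tailSum]
  | cons c u ih => simp only [List.cons_append, tailSum, ih, List.length_append]; ring

theorem tailSum_add (g g' : ZMod m → ℕ → ℤ) (u : List (ZMod m)) :
    tailSum (fun c x => g c x + g' c x) u = tailSum g u + tailSum g' u := by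
  induction u with
  | nil => simp [tailSum]
  | cons c u ih => simp only [tailSum, ih]; ring

theorem tailSum_mul_left (a : ℤ) (g : ZMod m → ℕ → ℤ) (u : List (ZMod m)) :
    tailSum (fun c x => a * g c x) u = a * tailSum g u := by
  induction u with
  | nil => simp [tailSum]
  | cons c u ih => simp only [tailSum, ih]; ring

theorem tailSum_sum {ι : Type*} (s : Finset ι) (g : ι → ZMod m → ℕ → ℤ) (u : List (ZMod m)) :
    tailSum (fun c x => ∑ i ∈ s, g i c x) u = ∑ i ∈ s, tailSum (g i) u := by
  induction u with
  | nil => simp [tailSum]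
  | cons c u ih => simp only [tailSum, ih, Finset.sum_add_distrib]

theorem tailSum_run (g : ZMod m → ℕ → ℤ) (c : ZMod m) (q : ℕ) :
    tailSum g (run m c q) = ∑ r ∈ Finset.range q, g (c + r) (q - 1 - r) := by
  induction q generalizing c with
  | zero => simp [run, tailSum]
  | succ q ih =>
    rw [run_succ, tailSum, ih, Finset.sum_range_succ', add_comm]
    congr 1
    · refine Finset.sum_congr rfl fun r _ => ?_
      congr 1
      · push_cast; ring
      · omega
    · simp

theorem tailSum_sigma (g : ZMod m → ℕ → ℤ) (w : List (ZMod m)) :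
    tailSum g (sigma m w) =
      tailSum (fun c x => ∑ r ∈ Finset.range m, g (c + (r : ZMod m)) (m - 1 - r + m * x)) w := by
  induction w with
  | nil => simp [tailSum]
  | cons c w ih => rw [sigma_cons, tailSum_append, ih, tailSum_run, tailSum, length_sigma]

theorem tailSum_eq_map_sum (h : ZMod m → ℤ) (u : List (ZMod m)) :
    tailSum (fun c _ => h c) u = (u.map h).sum := by
  induction u with
  | nil => simp [tailSum]
  | cons c u ih => simp [tailSum, ih]

end tailSum

/-! ### From binomial coefficients to power sums of positions -/

theorem countP_length_sublists' {α : Type*} (u : List α) (e : ℕ) :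
    u.sublists'.countP (fun x => x.length = e) = u.length.choose e := by
  induction u generalizing e with
  | nil => cases e <;> simp
  | cons c u ih =>
    rw [List.sublists'_cons, List.countP_append, List.countP_map, ih]
    cases e with
    | zero => simp [Function.comp_def]
    | succ e =>
      have : (fun x : List α => decide (x.length = e + 1)) ∘ List.cons c =
          fun x => decide (x.length = e) := by ext; simp
      rw [this, ih, List.length_cons, Nat.choose_succ_succ, add_comm]

theorem BinomEq.sum_map_sublists' {m k : ℕ} {u v : List (ZMod m)} (h : BinomEq k u v)
    (g : List (ZMod m) → ℤ) (hg : ∀ x, k < x.length → g x = 0) :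
    (u.sublists'.map g).sum = (v.sublists'.map g).sum := by
  have key : ∀ l : List (List (ZMod m)),
      (l.map g).sum = ((l.filter fun x => x.length ≤ k).map g).sum := by
    intro l
    induction l with
    | nil => simp
    | cons x l ih =>
      rw [List.filter_cons]
      split_ifs with hx
      · simp [ih]
      · simp [ih, hg x (by simpa using hx)]
  rw [key, key v.sublists']
  refine (List.Perm.map g (List.perm_iff_count.2 fun x => ?_)).sum_eq
  by_cases hx : x.length ≤ k
  · rw [List.count_filter (by simpa using hx), List.count_filter (by simpa using hx)]
    exact h x hx
  · rw [List.count_eq_zero.2 (by simp [hx]), List.count_eq_zero.2 (by simp [hx])]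

/-- A letter `c` followed by `x` letters starts `x.choose e` subwords of length `e + 1 ≤ k`; the sum
is therefore a linear combination of binomial coefficients of order at most `k`. -/
theorem BinomEq.tailSum_choose {m k : ℕ} {u v : List (ZMod m)} (h : BinomEq k u v)
    (f : ZMod m → ℤ) {e : ℕ} (he : e < k) :
    tailSum (fun c x => f c * x.choose e) u = tailSum (fun c x => f c * x.choose e) v := by
  let g : List (ZMod m) → ℤ
    | [] => 0
    | c :: x => if x.length = e then f c else 0
  have key : ∀ w : List (ZMod m),
      tailSum (fun c x => f c * x.choose e) w = (w.sublists'.map g).sum := by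
    intro w
    induction w with
    | nil => simp [tailSum, g]
    | cons c w ih =>
      have : ∀ l : List (List (ZMod m)),
          (l.map (g ∘ List.cons c)).sum = f c * l.countP (fun x => x.length = e) := by
        intro l
        induction l with
        | nil => simp
        | cons x l ih =>
          rw [List.map_cons, List.sum_cons, ih, List.countP_cons]
          simp only [Function.comp_apply, g, decide_eq_true_eq]
          split_ifs <;> push_cast <;> ring
      rw [tailSum, ih, List.sublists'_cons, List.map_append, List.map_map, List.sum_append, this,
        countP_length_sublists', add_comm]
  rw [key, key]
  refine h.sum_map_sublists' g fun x hx => ?_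
  cases x with
  | nil => rfl
  | cons c x =>
    rw [List.length_cons] at hx
    exact if_neg (by omega)

/-- `k`-binomial equivalence determines the power sums of degree `< k` of the positions of each
letter. -/
theorem BinomEq.tailSum_pow {m k : ℕ} {u v : List (ZMod m)} (h : BinomEq k u v)
    (f : ZMod m → ℤ) {d : ℕ} (hd : d < k) :
    tailSum (fun c x => f c * (x : ℤ) ^ d) u = tailSum (fun c x => f c * (x : ℤ) ^ d) v := by
  -- Mixed products let `x * C(x,e) = (e+1) * C(x,e+1) + e * C(x,e)` trade one power of `x` for a
  -- binomial coefficient.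
  suffices H : ∀ d e, d + e < k →
      tailSum (fun c x => f c * ((x : ℤ) ^ d * x.choose e)) u =
        tailSum (fun c x => f c * ((x : ℤ) ^ d * x.choose e)) v by
    simpa using H d 0 hd
  intro d
  induction d with
  | zero => intro e he; simpa using h.tailSum_choose f (e := e) (by omega)
  | succ d ih =>
    intro e he
    have key : ∀ w : List (ZMod m), tailSum (fun c x => f c * ((x : ℤ) ^ (d + 1) * x.choose e)) w =
        (e + 1 : ℤ) * tailSum (fun c x => f c * ((x : ℤ) ^ d * x.choose (e + 1))) w +
          e * tailSum (fun c x => f c * ((x : ℤ) ^ d * x.choose e)) w := by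
      intro w
      rw [← tailSum_mul_left, ← tailSum_mul_left, ← tailSum_add]
      congr 1
      ext c x
      have hx : (x.choose (e + 1) : ℤ) * (e + 1) = x.choose e * (x - e) := by
        rcases le_or_gt e x with hex | hex
        · have := Nat.choose_succ_right_eq x e
          zify [hex] at this
          exact this
        · rw [Nat.choose_eq_zero_of_lt hex, Nat.choose_eq_zero_of_lt (by omega)]; simp
      linear_combination (-(f c * (x : ℤ) ^ d)) * hx
    rw [key, key, ih (e + 1) (by omega), ih e (by omega)]

/-! ### Zero-sum weights and the descent through `σ_m` -/

/-- Functions on the alphabet with zero sum. -/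
def ZeroSum {m : ℕ} (h : ZMod m → ℤ) : Prop :=
  ∀ c, ∑ r ∈ Finset.range m, h (c + (r : ZMod m)) = 0

/-- The moment of order `s` of `h` over the block `σ_m(c)`. -/
def blockMoment {m : ℕ} (s : ℕ) (h : ZMod m → ℤ) (c : ZMod m) : ℤ :=
  ∑ r ∈ Finset.range m, ((m : ℤ) - 1 - r) ^ s * h (c + r)

theorem ZeroSum.blockMoment {m : ℕ} {h : ZMod m → ℤ} (hh : ZeroSum h) (s : ℕ) :
    ZeroSum (blockMoment s h) := by
  intro c
  simp only [ThueMorse.blockMoment]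
  rw [Finset.sum_comm]
  refine Finset.sum_eq_zero fun r _ => ?_
  rw [← Finset.mul_sum, ← mul_zero (((m : ℤ) - 1 - r) ^ s), ← hh (c + r)]
  congr 1
  refine Finset.sum_congr rfl fun i _ => ?_
  congr 1
  ring

theorem zeroSum_sub_shift {m : ℕ} (f : ZMod m → ℤ) : ZeroSum fun c => f c - f (c + 1) := by
  intro c
  have := Finset.sum_range_sub' (fun r : ℕ => f (c + (r : ZMod m))) m
  simpa [add_assoc] using this

/-- Abel summation. Up to the factor `m`, every zero-sum weight is thus the first moment of another
one, which makes the descent lose no information. -/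
theorem ZeroSum.blockMoment_one_shift_sub {m : ℕ} {h : ZMod m → ℤ} (hh : ZeroSum h) (c : ZMod m) :
    ThueMorse.blockMoment 1 (fun c => h c - h (c + 1)) c = m * h c := by
  have e := (Finset.sum_range_succ' (fun r : ℕ => ((m : ℤ) - r) * h (c + r)) m).symm.trans
    (Finset.sum_range_succ _ _)
  have hc := hh c
  have e' : ThueMorse.blockMoment 1 (fun c => h c - h (c + 1)) c =
      ∑ r ∈ Finset.range m, ((m : ℤ) - r) * h (c + r) - ∑ r ∈ Finset.range m, h (c + r) -
        ∑ r ∈ Finset.range m, ((m : ℤ) - (r + 1 : ℕ)) * h (c + (r + 1 : ℕ)) := by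
    rw [ThueMorse.blockMoment, ← Finset.sum_sub_distrib, ← Finset.sum_sub_distrib]
    refine Finset.sum_congr rfl fun r _ => ?_
    push_cast
    rw [add_assoc]
    ring
  rw [e', hc]
  simp only [sub_self, zero_mul, add_zero, Nat.cast_zero, sub_zero] at e
  linarith

/-- The `r`-th letter of a block with `x` blocks behind it has `m * x + (m - 1 - r)` letters after
it. In the expansion of the `d`-th power, the term `e = d` carries the sum of `h` over a block and
vanishes, so the degree drops. -/
theorem ZeroSum.tailSum_sigma_pow {m : ℕ} {h : ZMod m → ℤ} (hh : ZeroSum h) (d : ℕ)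
    (w : List (ZMod m)) :
    tailSum (fun c x => h c * (x : ℤ) ^ d) (sigma m w) =
      ∑ e ∈ Finset.range d, ((m : ℤ) ^ e * d.choose e) *
        tailSum (fun c x => ThueMorse.blockMoment (d - e) h c * (x : ℤ) ^ e) w := by
  rw [tailSum_sigma]
  simp_rw [← tailSum_mul_left]
  rw [← tailSum_sum]
  congr 1
  ext c x
  have e1 : ∀ r ∈ Finset.range m, h (c + r) * ((m - 1 - r + m * x : ℕ) : ℤ) ^ d =
      ∑ e ∈ Finset.range (d + 1),
        h (c + r) * ((m * x : ℤ) ^ e * ((m : ℤ) - 1 - r) ^ (d - e) * d.choose e) := by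
    intro r hr
    rw [Finset.mem_range] at hr
    rw [← Finset.mul_sum, ← add_pow]
    congr 2
    have : ((m - 1 - r : ℕ) : ℤ) = (m : ℤ) - 1 - r := by omega
    rw [Nat.cast_add, this]
    push_cast
    ring
  rw [Finset.sum_congr rfl e1, Finset.sum_comm, Finset.sum_range_succ]
  have e2 : ∑ r ∈ Finset.range m,
      h (c + r) * ((m * x : ℤ) ^ d * ((m : ℤ) - 1 - r) ^ (d - d) * d.choose d) = 0 := by
    simp only [Nat.sub_self, pow_zero, ← Finset.sum_mul, hh c, zero_mul]
  rw [e2, add_zero]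
  refine Finset.sum_congr rfl fun e _ => ?_
  rw [ThueMorse.blockMoment, Finset.sum_mul, Finset.mul_sum]
  refine Finset.sum_congr rfl fun r _ => ?_
  ring

theorem tailSum_sigmaPow_eq_of_perm {m : ℕ} {u v : List (ZMod m)} (huv : u.Perm v) (j : ℕ) :
    ∀ {h : ZMod m → ℤ}, ZeroSum h → ∀ {d : ℕ}, d ≤ j →
      tailSum (fun c x => h c * (x : ℤ) ^ d) (sigmaPow m j u) =
        tailSum (fun c x => h c * (x : ℤ) ^ d) (sigmaPow m j v) := by
  induction j with
  | zero =>
    intro h _ d hd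
    obtain rfl : d = 0 := by omega
    simp only [pow_zero, mul_one, tailSum_eq_map_sum]
    exact (huv.map h).sum_eq
  | succ j ih =>
    intro h hh d hd
    rw [sigmaPow_succ, sigmaPow_succ, hh.tailSum_sigma_pow, hh.tailSum_sigma_pow]
    refine Finset.sum_congr rfl fun e he => ?_
    rw [Finset.mem_range] at he
    rw [ih (hh.blockMoment _) (by omega)]

/-- Removing one `σ_m` from a sum of degree one too high leaves a single undetermined term: those of
lower degree agree by `tailSum_sigmaPow_eq_of_perm`, and the top one is a nonzero multiple of the
sum for `h` when the weight is `h c - h (c + 1)`. -/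
theorem tailSum_eq_of_sigmaPow {m : ℕ} (hm : 0 < m) {u v : List (ZMod m)} (huv : u.Perm v) (j : ℕ)
    (H : ∀ h : ZMod m → ℤ, ZeroSum h →
      tailSum (fun c x => h c * (x : ℤ) ^ (j + 1)) (sigmaPow m j u) =
        tailSum (fun c x => h c * (x : ℤ) ^ (j + 1)) (sigmaPow m j v))
    {h : ZMod m → ℤ} (hh : ZeroSum h) :
    tailSum (fun c x => h c * (x : ℤ)) u = tailSum (fun c x => h c * (x : ℤ)) v := by
  induction j with
  | zero => simpa [sigmaPow] using H h hh
  | succ j ih =>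
    refine ih fun h hh => ?_
    have H' := H _ (zeroSum_sub_shift h)
    rw [sigmaPow_succ, sigmaPow_succ, (zeroSum_sub_shift h).tailSum_sigma_pow,
      (zeroSum_sub_shift h).tailSum_sigma_pow, Finset.sum_range_succ,
      Finset.sum_range_succ _ (j + 1)] at H'
    have e : ∀ e ∈ Finset.range (j + 1), ((m : ℤ) ^ e * (j + 1 + 1).choose e) *
        tailSum (fun c x => blockMoment (j + 1 + 1 - e) (fun c => h c - h (c + 1)) c * (x : ℤ) ^ e)
          (sigmaPow m j u) = ((m : ℤ) ^ e * (j + 1 + 1).choose e) *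
        tailSum (fun c x => blockMoment (j + 1 + 1 - e) (fun c => h c - h (c + 1)) c * (x : ℤ) ^ e)
          (sigmaPow m j v) := by
      intro e he
      rw [Finset.mem_range] at he
      rw [tailSum_sigmaPow_eq_of_perm huv j ((zeroSum_sub_shift h).blockMoment _) (by omega)]
    rw [Finset.sum_congr rfl e, add_right_inj] at H'
    simp only [Nat.add_sub_cancel_left, hh.blockMoment_one_shift_sub, mul_assoc,
      tailSum_mul_left] at H'
    have hm' : (m : ℤ) ≠ 0 := by exact_mod_cast hm.ne'
    have hc : (((j + 1 + 1).choose (j + 1) : ℕ) : ℤ) ≠ 0 := by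
      exact_mod_cast (Nat.choose_pos (by omega)).ne'
    exact mul_left_cancel₀ hm' (mul_left_cancel₀ hc (mul_left_cancel₀ (pow_ne_zero _ hm') H'))

/-- If `σ_m^j` maps two abelian equivalent words to `(j+2)`-binomially equivalent ones, then the
position sums of the two words with zero-sum weights agree. -/
theorem BinomEq.tailSum_eq {m : ℕ} (hm : 0 < m) {u v : List (ZMod m)} (huv : u.Perm v) {j : ℕ}
    (H : BinomEq (j + 2) (sigmaPow m j u) (sigmaPow m j v)) {h : ZMod m → ℤ} (hh : ZeroSum h) :
    tailSum (fun c x => h c * (x : ℤ)) u = tailSum (fun c x => h c * (x : ℤ)) v :=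
  tailSum_eq_of_sigmaPow hm huv j (fun h _ => H.tailSum_pow h (by omega)) hh

/-! ### Position sums of `run ++ sigma w ++ run` and recovery of the cut -/

section shift

variable {m : ℕ} (f : ZMod m → ℤ)

theorem tailSum_shift_run_append (c : ZMod m) (q : ℕ) (v : List (ZMod m)) :
    tailSum (fun c x => (f c - f (c + 1)) * (x : ℤ)) (run m c q ++ v) =
      (v.length + q) * f c - v.length * f (c + q) - ((run m c q).map f).sum +
        tailSum (fun c x => (f c - f (c + 1)) * (x : ℤ)) v := by
  induction q generalizing c with
  | zero => simp [run]
  | succ q ih =>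
    rw [run_succ, List.cons_append, tailSum, ih, List.map_cons, List.sum_cons, List.length_append,
      length_run]
    push_cast
    rw [show c + 1 + (q : ZMod m) = c + (q + 1) by ring]
    ring

/-- Since `c + m = c`, the boundary terms of a full block combine to `m * f c`, independently of
what follows it. -/
theorem tailSum_shift_sigma_append (w v : List (ZMod m)) :
    tailSum (fun c x => (f c - f (c + 1)) * (x : ℤ)) (sigma m w ++ v) =
      m * (w.map f).sum - ((sigma m w).map f).sum +
        tailSum (fun c x => (f c - f (c + 1)) * (x : ℤ)) v := by
  induction w with
  | nil => simp
  | cons c w ih =>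
    rw [sigma_cons, List.append_assoc, tailSum_shift_run_append, ih]
    simp
    ring

theorem tailSum_shift_parse (c b : ZMod m) (q r : ℕ) (w : List (ZMod m)) :
    tailSum (fun c x => (f c - f (c + 1)) * (x : ℤ)) (run m c q ++ sigma m w ++ run m b r) =
      (q + m * w.length + r) * f c - (m * w.length + r) * f (c + q) + m * (w.map f).sum + r * f b -
        ((run m c q ++ sigma m w ++ run m b r).map f).sum := by
  have h := tailSum_shift_run_append f b r []
  rw [List.append_nil] at h
  rw [List.append_assoc, tailSum_shift_run_append, tailSum_shift_sigma_append, h]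
  simp [tailSum, length_sigma]
  ring

end shift

theorem sum_map_indicator {m : ℕ} (a : ZMod m) (w : List (ZMod m)) :
    (w.map fun c => if c = a then (1 : ℤ) else 0).sum = w.count a := by
  induction w with
  | nil => simp
  | cons c w ih =>
    rw [List.map_cons, List.sum_cons, ih, List.count_cons]
    by_cases h : c = a <;> simp [h, add_comm]

theorem add_natCast_ne_self {m : ℕ} {q : ℕ} (h0 : 0 < q) (hq : q < m) (c : ZMod m) :
    c + (q : ZMod m) ≠ c := by
  intro h
  have : (q : ZMod m) = 0 := by simpa using h
  rw [ZMod.natCast_eq_zero_iff] at this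
  exact absurd (Nat.le_of_dvd h0 this) (by omega)

theorem eq_of_add_natCast_eq {m : ℕ} {q q' : ℕ} (hq : q < m) (hq' : q' < m) {c : ZMod m}
    (h : c + (q : ZMod m) = c + q') : q = q' := by
  have h' := (ZMod.natCast_eq_natCast_iff' q q' m).1 (add_left_cancel h)
  rwa [Nat.mod_eq_of_lt hq, Nat.mod_eq_of_lt hq'] at h'

/-- The numerical core of the comparison of two parsings `run ++ sigma w ++ run` of words with the
same letters and the same position sums: the left ends are equal. -/
theorem left_run_eq {m : ℕ} {q r q' r' : ℕ} {c b c' b' : ZMod m} {w w' : List (ZMod m)}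
    (hq : q < m) (hq' : q' < m)
    (hw : ∀ a, w.count a < w.length) (hw' : ∀ a, w'.count a < w'.length)
    (hn : q + m * w.length + r = q' + m * w'.length + r')
    (H : ∀ f : ZMod m → ℤ,
      (q + m * w.length + r) * f c - (m * w.length + r) * f (c + q) + m * (w.map f).sum + r * f b =
        (q' + m * w'.length + r') * f c' - (m * w'.length + r') * f (c' + q') +
          m * (w'.map f).sum + r' * f b') :
    q = q' ∧ (q = 0 ∨ c = c') := by
  have hm : (0 : ℤ) < m := by omega
  have ind : ∀ p : Prop, [Decidable p] → (0 : ℤ) ≤ (if p then 1 else 0) ∧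
      (if p then (1 : ℤ) else 0) ≤ 1 := by
    intro p _; split_ifs <;> simp
  have hnz : (q + m * w.length + r : ℤ) = q' + m * w'.length + r' := by exact_mod_cast hn
  have hpos : (0 : ℤ) ≤ m * w.length := by positivity
  have hpos' : (0 : ℤ) ≤ m * w'.length := by positivity
  have K := fun a => H fun c => if c = a then (1 : ℤ) else 0
  simp only [sum_map_indicator] at K
  -- As `w` is not a power of `a`, there is a margin of `m`; it decides every inequality below.
  have L : ∀ a, (m : ℤ) * w.count a + m ≤ m * w.length := by
    intro a
    have : (w.count a : ℤ) + 1 ≤ w.length := by exact_mod_cast hw a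
    nlinarith
  have L' : ∀ a, (m : ℤ) * w'.count a + m ≤ m * w'.length := by
    intro a
    have : (w'.count a : ℤ) + 1 ≤ w'.length := by exact_mod_cast hw' a
    nlinarith
  have N : ∀ a, (0 : ℤ) ≤ m * w.count a := fun a => by positivity
  have N' : ∀ a, (0 : ℤ) ≤ m * w'.count a := fun a => by positivity
  have I : ∀ (p : Prop) [Decidable p] (t : ℕ), (0 : ℤ) ≤ t * (if p then 1 else 0) ∧
      t * (if p then (1 : ℤ) else 0) ≤ t := by
    intro p _ t; split_ifs <;> simp
  -- Testing at the first letter of a nonempty left run gives one side at least the total length,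
  -- which the other side cannot reach unless its left run starts with the same letter.
  rcases Nat.eq_zero_or_pos q with hq0 | hq0 <;> rcases Nat.eq_zero_or_pos q' with hq0' | hq0'
  · exact ⟨by omega, .inl hq0⟩
  · exfalso
    have k := K c'
    subst hq0
    rw [if_pos rfl, if_neg (add_natCast_ne_self hq0' hq' c')] at k
    simp only [Nat.cast_zero, add_zero, zero_add] at k hnz
    have := L c'; have := N' c'; have := I (b = c') r; have := I (b' = c') r'
    linarith
  · exfalso
    have k := K c
    subst hq0'
    rw [if_pos rfl, if_neg (add_natCast_ne_self hq0 hq c)] at k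
    simp only [Nat.cast_zero, add_zero, zero_add] at k hnz
    have := L' c; have := N c; have := I (b = c) r; have := I (b' = c) r'
    linarith
  · have hcc : c = c' := by
      by_contra hcc
      have k := K c
      rw [if_pos rfl, if_neg (add_natCast_ne_self hq0 hq c), if_neg (Ne.symm hcc)] at k
      have := L' c; have := N c; have := I (b = c) r; have := I (b' = c) r'
      have : (0 : ℤ) ≤ (m * w'.length + r') * (if c' + (q' : ZMod m) = c then 1 else 0) :=
        mul_nonneg (by positivity) (ind _).1
      linarith
    refine ⟨?_, .inr hcc⟩
    subst hcc
    by_contra hqq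
    -- At the letter just after the left run, the left side is at most `-m` while the right side is
    -- nonnegative.
    have k := K (c + q)
    rw [if_pos rfl, if_neg (add_natCast_ne_self hq0 hq c).symm,
      if_neg fun h => hqq (eq_of_add_natCast_eq hq' hq h).symm] at k
    have := L (c + q); have := N' (c + q); have := I (b = c + q) r; have := I (b' = c + q) r'
    linarith

/-- Two words `run ++ sigma w ++ run` with the same letters and the same position sums are parsed
in the same way, provided that `w` and `w'` are not powers of a letter. -/
theorem parse_eq {m : ℕ} {q r q' r' : ℕ} {c b c' b' : ZMod m} {w w' : List (ZMod m)}
    (hq : q < m) (hr : r < m) (hq' : q' < m) (hr' : r' < m)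
    (hw : ∀ a, w.count a < w.length) (hw' : ∀ a, w'.count a < w'.length)
    (hp : (run m c q ++ sigma m w ++ run m b r).Perm (run m c' q' ++ sigma m w' ++ run m b' r'))
    (H : ∀ h : ZMod m → ℤ, ZeroSum h →
      tailSum (fun c x => h c * (x : ℤ)) (run m c q ++ sigma m w ++ run m b r) =
        tailSum (fun c x => h c * (x : ℤ)) (run m c' q' ++ sigma m w' ++ run m b' r')) :
    run m c q = run m c' q' ∧ run m b r = run m b' r' ∧ w.Perm w' := by
  have hn : q + m * w.length + r = q' + m * w'.length + r' := by
    simpa [length_sigma, add_assoc] using hp.length_eq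
  have E : ∀ f : ZMod m → ℤ,
      (q + m * w.length + r) * f c - (m * w.length + r) * f (c + q) + m * (w.map f).sum + r * f b =
        (q' + m * w'.length + r') * f c' - (m * w'.length + r') * f (c' + q') +
          m * (w'.map f).sum + r' * f b' := by
    intro f
    have h1 := H _ (zeroSum_sub_shift f)
    rw [tailSum_shift_parse, tailSum_shift_parse, (hp.map f).sum_eq] at h1
    linarith
  obtain ⟨rfl, hc⟩ := left_run_eq hq hq' hw hw' hn E
  have hm : 0 < m := by omega
  -- The left runs now contribute equally; reducing modulo `m` will isolate the right run.
  have E' : ∀ a, m * w.count a + r * (if b = a then 1 else 0) =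
      m * w'.count a + r' * (if b' = a then 1 else 0) := by
    intro a
    have k := E fun c => if c = a then (1 : ℤ) else 0
    simp only [sum_map_indicator] at k
    have hnz : (m * w.length + r : ℤ) = m * w'.length + r' := by
      have : m * w.length + r = m * w'.length + r' := by omega
      exact_mod_cast this
    rw [add_assoc, add_assoc (q : ℤ), hnz] at k
    zify
    rcases hc with hc | hc
    · subst hc
      simp only [Nat.cast_zero, add_zero, zero_add] at k
      linarith
    · subst hc
      linarith
  have hrr : r = r' := by
    have h1 : r % m = r' % m := by
      have h2 := congrArg (· % m) (show m * w.length + r = m * w'.length + r' by omega)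
      simpa using h2
    rwa [Nat.mod_eq_of_lt hr, Nat.mod_eq_of_lt hr'] at h1
  subst hrr
  have hb : r = 0 ∨ b = b' := by
    rcases Nat.eq_zero_or_pos r with h0 | h0
    · exact .inl h0
    · refine .inr ?_
      by_contra hbb
      have k := E' b
      rw [if_pos rfl, if_neg (Ne.symm hbb)] at k
      have h2 := congrArg (· % m) k
      simp [Nat.mod_eq_of_lt hr] at h2
      omega
  refine ⟨?_, ?_, List.perm_iff_count.2 fun a => ?_⟩
  · rcases hc with rfl | rfl <;> rfl
  · rcases hb with rfl | rfl <;> rfl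
  · have k := E' a
    rcases hb with hb | hb
    · subst hb
      simpa [hm.ne'] using k
    · subst hb
      exact Nat.eq_of_mul_eq_mul_left hm (Nat.add_right_cancel k)

/-! ### Blocks of `t_m`: no letter cubes, synchronization -/

theorem getElem?_sigma {m : ℕ} (w : List (ZMod m)) (n : ℕ) {r : ℕ} (hr : r < m) :
    (sigma m w)[m * n + r]? = w[n]?.map (· + (r : ZMod m)) := by
  induction w generalizing n with
  | nil => simp
  | cons c w ih =>
    rw [sigma_cons]
    cases n with
    | zero => rw [List.getElem?_append_left (by simpa using hr)]; simp [run, hr]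
    | succ n =>
      rw [List.getElem?_append_right (by simp; nlinarith), length_run,
        show m * (n + 1) + r - m = m * n + r by rw [mul_add]; omega, ih]
      simp

theorem word_mul_add {m : ℕ} (hm : 2 ≤ m) (n : ℕ) {r : ℕ} (hr : r < m) :
    word m (m * n + r) = word m n + r := by
  have hn : n < m ^ n := Nat.lt_pow_self (by omega)
  have h1 : m * n + r < m ^ (n + 1) := by
    rw [pow_succ]; nlinarith
  have h := getElem?_sigmaPow_zero hm h1
  rw [sigmaPow_succ, getElem?_sigma _ _ hr, getElem?_sigmaPow_zero hm hn] at h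
  simpa using h.symm

theorem word_mul {m : ℕ} (hm : 2 ≤ m) (n : ℕ) : word m (m * n) = word m n := by
  simpa using word_mul_add hm n (r := 0) (by omega)

/-- No letter is repeated three times in a row in `t_m`. -/
theorem word_not_cube {m : ℕ} (hm : 2 ≤ m) (i : ℕ) :
    ¬ (word m i = word m (i + 1) ∧ word m (i + 1) = word m (i + 2)) := by
  -- Inside a block `σ_m(c)` neighbours differ by 1, so equal neighbours straddle a block boundary;
  -- two consecutive positions cannot both do so.
  have key : ∀ n, n % m + 1 < m → word m n ≠ word m (n + 1) := by
    intro n hn h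
    have e1 := word_mul_add hm (n / m) (r := n % m) (by omega)
    have e2 := word_mul_add hm (n / m) hn
    rw [Nat.div_add_mod] at e1
    rw [← add_assoc, Nat.div_add_mod, ← h, e1] at e2
    have : Fact (1 < m) := ⟨by omega⟩
    simp at e2
  rintro ⟨h1, h2⟩
  have hlt : i % m < m := Nat.mod_lt _ (by omega)
  by_cases hi : i % m + 1 < m
  · exact key i hi h1
  · refine key (i + 1) ?_ h2
    have : (i + 1) % m = 0 := by
      rw [Nat.add_mod, show i % m = m - 1 by omega, Nat.mod_eq_of_lt (show 1 < m by omega),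
        Nat.sub_add_cancel (by omega), Nat.mod_self]
    omega

/-- The block of `n` letters of `t_m` starting at position `i`. -/
def block (m i n : ℕ) : List (ZMod m) := (List.range n).map fun j => word m (i + j)

@[simp] theorem length_block (m i n : ℕ) : (block m i n).length = n := by simp [block]

@[simp] theorem block_zero (m i : ℕ) : block m i 0 = [] := rfl

theorem getElem?_block (m i : ℕ) {n j : ℕ} (hj : j < n) :
    (block m i n)[j]? = some (word m (i + j)) := by simp [block, hj]

theorem block_add (m i n n' : ℕ) : block m i (n + n') = block m i n ++ block m (i + n) n' := by
  simp [block, List.range_add, Function.comp_def, add_assoc]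

theorem block_mul_eq_run {m : ℕ} (hm : 2 ≤ m) (e : ℕ) {q : ℕ} (hq : q ≤ m) :
    block m (m * e) q = run m (word m e) q := by
  refine List.map_congr_left fun j hj => ?_
  rw [List.mem_range] at hj
  exact word_mul_add hm e (by omega)

/-- A block shorter than `m` that ends at a multiple of `m` is a run. -/
theorem exists_block_eq_run {m : ℕ} (hm : 2 ≤ m) {i q e : ℕ} (hq : q < m) (h : i + q = m * e) :
    ∃ c, block m i q = run m c q := by
  rcases Nat.eq_zero_or_pos q with rfl | h0
  · exact ⟨0, rfl⟩
  obtain ⟨e, rfl⟩ : ∃ n, e = n + 1 := by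
    refine ⟨e - 1, ?_⟩
    rcases Nat.eq_zero_or_pos e with rfl | h1
    · simp at h; omega
    · omega
  refine ⟨word m e + (m - q : ℕ), List.map_congr_left fun j hj => ?_⟩
  rw [List.mem_range] at hj
  rw [mul_add] at h
  rw [show i + j = m * e + (m - q + j) by omega, word_mul_add hm e (by omega)]
  push_cast
  ring

theorem sigma_block {m : ℕ} (hm : 2 ≤ m) (i n : ℕ) :
    sigma m (block m i n) = block m (m * i) (m * n) := by
  induction n with
  | zero => simp
  | succ n ih =>
    rw [mul_add, block_add, block_add, sigma_append, ih, ← mul_add, mul_one,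
      block_mul_eq_run hm _ le_rfl, show block m (i + n) 1 = [word m (i + n)] by simp [block],
      sigma_cons, sigma_nil, List.append_nil]

theorem sigmaPow_block {m : ℕ} (hm : 2 ≤ m) (j i n : ℕ) :
    sigmaPow m j (block m i n) = block m (m ^ j * i) (m ^ j * n) := by
  induction j with
  | zero => simp [sigmaPow]
  | succ j ih => rw [sigmaPow_succ, ih, sigma_block hm, pow_succ', mul_assoc, mul_assoc]

theorem count_block_lt {m : ℕ} (hm : 2 ≤ m) (i : ℕ) {n : ℕ} (hn : 3 ≤ n) (a : ZMod m) :
    (block m i n).count a < (block m i n).length := by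
  refine lt_of_le_of_ne List.count_le_length fun h => ?_
  rw [List.count_eq_length] at h
  have key : ∀ j < n, a = word m (i + j) := fun j hj =>
    h _ (List.mem_map.2 ⟨j, List.mem_range.2 hj, rfl⟩)
  have h0 := key 0 (by omega)
  have h1 := key 1 (by omega)
  have h2 := key 2 (by omega)
  exact word_not_cube hm i ⟨h0.symm.trans h1, h1.symm.trans h2⟩

/-- Occurrences of `σ_m(y)` in `t_m` are synchronized with the blocks `σ_m(c)`. -/
theorem sigma_eq_block {m : ℕ} (hm : 2 ≤ m) {y : List (ZMod m)} (hy : 2 ≤ y.length) {i n : ℕ}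
    (h : sigma m y = block m i n) : ∃ e, i = m * e ∧ y = block m e y.length := by
  have hn : m * y.length = n := by simpa [length_sigma] using congrArg List.length h
  have L : ∀ l (hl : l < y.length), ∀ r < m, word m (i + (m * l + r)) = y[l] + r := by
    intro l hl r hr
    have h1 := getElem?_sigma y l hr
    rw [h, getElem?_block, List.getElem?_eq_getElem hl] at h1
    · simpa using h1
    · rw [← hn]; nlinarith
  have hi : m * (i / m) + i % m = i := Nat.div_add_mod i m
  have hlt : i % m < m := Nat.mod_lt _ (by omega)
  have h0 : i % m = 0 := by
    by_contra h0
    -- With a nonzero offset, a block boundary of `t_m` lies inside `σ_m(y[l])`, so the letters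
    -- around it differ by 1. The last letter of a block `σ_m(c)` is `c - 1`, hence the next block
    -- starts with `c`; taking `l = 0, 1` gives a cube.
    have key : ∀ l < y.length, word m (i / m + l) = word m (i / m + l + 1) := by
      intro l hl
      have e1 := L l hl (m - 1 - i % m) (by omega)
      have e2 := L l hl (m - i % m) (by omega)
      rw [show i + (m * l + (m - 1 - i % m)) = m * (i / m + l) + (m - 1) by
        rw [mul_add]; omega, word_mul_add hm _ (by omega)] at e1
      rw [show i + (m * l + (m - i % m)) = m * (i / m + l + 1) by
        rw [mul_add, mul_add]; omega, word_mul hm,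
        show m - i % m = m - 1 - i % m + 1 by omega, Nat.cast_succ, ← add_assoc, ← e1] at e2
      have e3 : ((m - 1 : ℕ) : ZMod m) + 1 = 0 := by
        rw [← Nat.cast_succ, show (m - 1).succ = m by omega, ZMod.natCast_self]
      rw [e2, add_assoc, e3, add_zero]
    exact word_not_cube hm (i / m) ⟨key 0 (by omega), key 1 (by omega)⟩
  refine ⟨i / m, by omega, List.ext_getElem (by simp) fun l hl _ => ?_⟩
  have e := L l hl 0 (by omega)
  rw [show i + (m * l + 0) = m * (i / m + l) by rw [mul_add]; omega, word_mul hm] at e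
  simpa [block] using e.symm

theorem sigmaPow_eq_block {m : ℕ} (hm : 2 ≤ m) (j : ℕ) {y : List (ZMod m)} (hy : 2 ≤ y.length)
    {i n : ℕ} (h : sigmaPow m j y = block m i n) :
    ∃ e, i = m ^ j * e ∧ y = block m e y.length := by
  induction j generalizing i n with
  | zero =>
    have h' : y = block m i n := h
    exact ⟨i, by simp, by rw [h', length_block]⟩
  | succ j ih =>
    rw [sigmaPow_succ] at h
    have h2 : 2 ≤ (sigmaPow m j y).length := by
      rw [length_sigmaPow]
      exact hy.trans (Nat.le_mul_of_pos_left _ (pow_pos (by omega) _))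
    obtain ⟨e, rfl, he⟩ := sigma_eq_block hm h2 h
    obtain ⟨e', rfl, he'⟩ := ih he
    exact ⟨e', by ring, he'⟩

/-! ### Comparing the cuts of two factors -/

/-- Two blocks of `t_m` that are `(j+1)`-binomially equivalent are cut in the same way by the
blocks of `σ_m^j`, and their desubstitutions are abelian equivalent. -/
theorem parse_eq_of_binomEq {m : ℕ} (hm : 2 ≤ m) (j : ℕ) {n i q e N r i' q' e' N' r' : ℕ}
    (hi : i + q = m ^ j * e) (hq : q < m ^ j) (hr : r < m ^ j) (hN : 3 ≤ N)
    (hi' : i' + q' = m ^ j * e') (hq' : q' < m ^ j) (hr' : r' < m ^ j) (hN' : 3 ≤ N')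
    (hn : q + m ^ j * N + r = n) (hn' : q' + m ^ j * N' + r' = n)
    (h : BinomEq (j + 1) (block m i n) (block m i' n)) :
    block m i q = block m i' q' ∧ block m (m ^ j * (e + N)) r = block m (m ^ j * (e' + N')) r' ∧
      (block m e N).Perm (block m e' N') := by
  induction j generalizing q e N r q' e' N' r' with
  | zero =>
    simp only [pow_zero, Nat.lt_one_iff, one_mul] at *
    subst hq hr hq' hr'
    obtain rfl : i = e := hi
    obtain rfl : i' = e' := hi'
    obtain rfl : N = n := by omega
    obtain rfl : N' = N := by omega
    exact ⟨rfl, rfl, binomEq_one_iff.1 h⟩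
  | succ j ih =>
    have hpos : 0 < m ^ j := pow_pos (by omega) j
    -- One level of desubstitution, for both words.
    have split : ∀ {i q e N r : ℕ}, i + q = m ^ (j + 1) * e → q < m ^ (j + 1) → r < m ^ (j + 1) →
        q + m ^ (j + 1) * N + r = n →
        ∃ q₂ a r₂ b e₂, q = q₂ + m ^ j * a ∧ r = m ^ j * b + r₂ ∧ q₂ < m ^ j ∧ r₂ < m ^ j ∧
          a < m ∧ b < m ∧ i + q₂ = m ^ j * e₂ ∧ e₂ + a = m * e ∧
          q₂ + m ^ j * (a + m * N + b) + r₂ = n := by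
      intro i q e N r hi hq hr hn
      have h1 := Nat.mod_add_div q (m ^ j)
      have h2 := Nat.div_add_mod r (m ^ j)
      have h3 := Nat.mul_div_le q (m ^ j)
      rw [pow_succ] at hq hr
      have ha : q / m ^ j < m := Nat.div_lt_of_lt_mul hq
      have hb : r / m ^ j < m := Nat.div_lt_of_lt_mul hr
      have hle : q / m ^ j ≤ m * e := by
        refine Nat.le_of_mul_le_mul_left ?_ hpos
        rw [← mul_assoc, ← pow_succ, ← hi]
        omega
      refine ⟨q % m ^ j, q / m ^ j, r % m ^ j, r / m ^ j, m * e - q / m ^ j, h1.symm, h2.symm,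
        Nat.mod_lt _ hpos, Nat.mod_lt _ hpos, ha, hb, ?_, Nat.sub_add_cancel hle, ?_⟩
      · rw [Nat.mul_sub, ← mul_assoc, ← pow_succ, ← hi]
        omega
      · rw [mul_add, mul_add, ← mul_assoc, ← pow_succ]
        omega
    obtain ⟨q₂, a, r₂, b, e₂, rfl, rfl, hq₂, hr₂, ha, hb, hi₂, he₂, hn₂⟩ := split hi hq hr hn
    obtain ⟨q₂', a', r₂', b', e₂', rfl, rfl, hq₂', hr₂', ha', hb', hi₂', he₂', hn₂'⟩ :=
      split hi' hq' hr' hn'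
    have hmN : ∀ x y {M : ℕ}, 3 ≤ M → 3 ≤ x + m * M + y := by intro x y M hM; nlinarith
    obtain ⟨hL, hR, hP⟩ := ih hi₂ hq₂ hr₂ (hmN a b hN) hi₂' hq₂' hr₂' (hmN a' b' hN') hn₂ hn₂'
      (h.mono (by omega))
    -- The middle parts.
    have mid : ∀ {i q₂ e₂ M r₂ : ℕ}, i + q₂ = m ^ j * e₂ → q₂ + m ^ j * M + r₂ = n →
        block m i n = block m i q₂ ++ sigmaPow m j (block m e₂ M) ++
          block m (m ^ j * (e₂ + M)) r₂ := by
      intro i q₂ e₂ M r₂ h1 h2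
      rw [← h2, block_add, block_add, sigmaPow_block hm, h1, mul_add, ← h1, add_assoc]
    rw [mid hi₂ hn₂, mid hi₂' hn₂', ← hL, ← hR] at h
    have hB := h.append_right_cancel.append_left_cancel
    have parse : ∀ {e₂ a e : ℕ} (N b : ℕ), e₂ + a = m * e → a < m → b < m →
        ∃ c d, block m e₂ a = run m c a ∧ block m (m * (e + N)) b = run m d b ∧
          block m e₂ (a + m * N + b) = run m c a ++ sigma m (block m e N) ++ run m d b := by
      intro e₂ a e N b h1 ha hb
      obtain ⟨c, hc⟩ := exists_block_eq_run hm ha h1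
      refine ⟨c, word m (e + N), hc, block_mul_eq_run hm _ hb.le, ?_⟩
      rw [block_add, block_add, hc, sigma_block hm, h1, ← block_mul_eq_run hm _ hb.le, mul_add,
        ← h1, add_assoc]
    obtain ⟨c, d, hc, hd, hW⟩ := parse N b he₂ ha hb
    obtain ⟨c', d', hc', hd', hW'⟩ := parse N' b' he₂' ha' hb'
    -- Only here is the full order `j + 2` used; `ih` needed order `j + 1`.
    have hT := fun (g : ZMod m → ℤ) (hg : ZeroSum g) => hB.tailSum_eq (by omega) hP hg
    rw [hW, hW'] at hP
    simp only [hW, hW'] at hT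
    obtain ⟨k1, k2, k3⟩ := parse_eq ha hb ha' hb' (count_block_lt hm e hN) (count_block_lt hm e' hN')
      hP hT
    have ends : ∀ {e₂ a e : ℕ} (N b : ℕ), e₂ + a = m * e →
        e₂ + (a + m * N + b) = m * (e + N) + b := by
      intro e₂ a e N b h1; rw [mul_add, ← h1]; ring
    refine ⟨?_, ?_, k3⟩
    · rw [block_add, block_add, hL, hi₂, hi₂', ← sigmaPow_block hm, ← sigmaPow_block hm, hc, hc', k1]
    · rw [ends N b he₂, ends N' b' he₂'] at hR
      rw [block_add, block_add, pow_succ, mul_assoc, mul_assoc, ← mul_add, ← mul_add, hR,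
        ← sigmaPow_block hm, ← sigmaPow_block hm, hd, hd', k2]

/-! ### The relation `≡_k` and part (1) -/

/-- Abelian equivalence of the words `α σ_m(u) β` in terms of their short ends. -/
theorem perm_ends_iff {m : ℕ} (hm : 0 < m) {α u β α' v β' : List (ZMod m)}
    (hα : α.length < m) (hβ : β.length < m) (hα' : α'.length < m) (hβ' : β'.length < m)
    (hlen : (α ++ sigma m u ++ β).length = (α' ++ sigma m v ++ β').length) :
    (α ++ sigma m u ++ β).Perm (α' ++ sigma m v ++ β') ↔
      BinomEq 1 (α ++ β) (α' ++ β') ∨ BinomEq 1 (α ++ β) (α' ++ β' ++ sigma m [0]) ∨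
        BinomEq 1 (α ++ β ++ sigma m [0]) (α' ++ β') := by
  simp only [List.length_append, length_sigma] at hlen
  simp only [binomEq_one_iff]
  constructor
  · intro h
    rw [List.perm_iff_count] at h
    simp only [List.count_append, count_sigma hm] at h
    -- The ends have total length below `2 * m`, so `|u|` and `|v|` differ by at most 1. Every
    -- letter occurs `|u|` times in `σ_m(u)`, so one copy of `σ_m(0)` accounts for a difference of
    -- 1.
    have h1 : u.length < v.length + 2 := by
      by_contra h1
      have : m * (v.length + 2) ≤ m * u.length := Nat.mul_le_mul_left _ (by omega)
      rw [mul_add] at this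
      omega
    have h2 : v.length < u.length + 2 := by
      by_contra h2
      have : m * (u.length + 2) ≤ m * v.length := Nat.mul_le_mul_left _ (by omega)
      rw [mul_add] at this
      omega
    have h3 : u.length = v.length ∨ v.length = u.length + 1 ∨ u.length = v.length + 1 := by omega
    refine h3.imp (fun h3 => ?_) (Or.imp (fun h3 => ?_) fun h3 => ?_) <;>
    · refine List.perm_iff_count.2 fun a => ?_
      have := h a
      simp only [List.count_append, count_sigma hm, List.length_singleton]
      omega
  · intro h
    have cancel : ∀ {x y d : ℕ}, m * x + m * d = m * y → x + d = y := fun h =>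
      Nat.eq_of_mul_eq_mul_left hm (by rw [mul_add, h])
    refine List.perm_iff_count.2 fun a => ?_
    simp only [List.count_append, count_sigma hm]
    rcases h with h | h | h <;>
    · have h1 := h.length_eq
      have h2 := h.count_eq a
      simp only [List.length_append, List.count_append, count_sigma hm, length_sigma,
        List.length_singleton] at h1 h2
      first
      | have := cancel (x := u.length) (y := v.length) (d := 0) (by omega)
        omega
      | have := cancel (x := u.length) (y := v.length) (d := 1) (by omega)
        omega
      | have := cancel (x := v.length) (y := u.length) (d := 1) (by omega)
        omega

theorem length_append_sigmaPow_lt {m j : ℕ} {p α : List (ZMod m)} (hp : p.length < m ^ j)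
    (hα : α.length < m) : p.length + m ^ j * α.length < m ^ (j + 1) := by
  have : m ^ j * (α.length + 1) ≤ m ^ j * m := Nat.mul_le_mul_left _ hα
  rw [pow_succ]
  rw [mul_add] at this
  omega

/-- The bound `2 * m ^ k` on the length enters here: for `m ≥ 2` the middle word has at least `2 * m
- 1 ≥ 3` letters, as the absence of cubes requires. -/
theorem pow_mul_length_le {m j : ℕ} {p w s : List (ZMod m)} (hp : p.length < m ^ j)
    (hs : s.length < m ^ j) (h : 2 * m ^ (j + 1) ≤ (p ++ sigmaPow m j w ++ s).length) :
    2 * m ≤ w.length + 1 := by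
  simp only [List.length_append, length_sigmaPow] at h
  have h2 : m ^ j * (2 * m) < m ^ j * (w.length + 2) := by
    rw [mul_add, show m ^ j * (2 * m) = 2 * m ^ (j + 1) by ring]
    omega
  have := Nat.lt_of_mul_lt_mul_left h2
  omega

/-- A decomposition of a factor along `σ_m^j` comes from its position in `t_m`. -/
theorem IsFactor.exists_block {m : ℕ} (hm : 2 ≤ m) {j : ℕ} {U p w s : List (ZMod m)}
    (hU : IsFactor m U) (h : U = p ++ sigmaPow m j w ++ s) (hw : 2 ≤ w.length) :
    ∃ i e, U = block m i U.length ∧ i + p.length = m ^ j * e ∧ w = block m e w.length ∧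
      p = block m i p.length ∧ s = block m (m ^ j * (e + w.length)) s.length := by
  obtain ⟨i, hi⟩ := hU
  have hi' : U = block m i U.length := hi
  have hl : U.length = p.length + m ^ j * w.length + s.length := by
    rw [h]; simp [length_sigmaPow, add_assoc]
  have h' := hi'
  rw [hl, block_add, block_add, h] at h'
  obtain ⟨h1, hs⟩ := List.append_inj h' (by simp [length_sigmaPow])
  obtain ⟨hp, hw'⟩ := List.append_inj h1 (by simp)
  obtain ⟨e, he, hwe⟩ := sigmaPow_eq_block hm j hw hw'
  refine ⟨i, e, hi', he, hwe, hp, ?_⟩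
  rwa [← add_assoc, he, ← mul_add] at hs

theorem pairEq_of_binomEq {m : ℕ} (hm : 2 ≤ m) {j : ℕ} {U V : List (ZMod m)}
    (hU : IsFactor m U) (hV : IsFactor m V) (hlen : U.length = V.length)
    (hlong : 2 * m ^ (j + 1) ≤ U.length) {pU αu u βu sU pV αv v βv sV : List (ZMod m)}
    (hUe : U = pU ++ sigmaPow m j (αu ++ sigma m u ++ βu) ++ sU)
    (hVe : V = pV ++ sigmaPow m j (αv ++ sigma m v ++ βv) ++ sV)
    (hpU : pU.length < m ^ j) (hsU : sU.length < m ^ j)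
    (hpV : pV.length < m ^ j) (hsV : sV.length < m ^ j)
    (hαu : αu.length < m) (hβu : βu.length < m) (hαv : αv.length < m) (hβv : βv.length < m)
    (h : BinomEq (j + 1) U V) :
    PairEq m (j + 1) (pU ++ sigmaPow m j αu, sigmaPow m j βu ++ sU)
      (pV ++ sigmaPow m j αv, sigmaPow m j βv ++ sV) := by
  have hwU := pow_mul_length_le hpU hsU (hUe ▸ hlong)
  have hwV := pow_mul_length_le hpV hsV (hVe ▸ hlen ▸ hlong)
  obtain ⟨i, e, hUb, hi, hWU, hpUb, hsUb⟩ := hU.exists_block hm hUe (by omega)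
  obtain ⟨i', e', hVb, hi', hWV, hpVb, hsVb⟩ := hV.exists_block hm hVe (by omega)
  have hlU : pU.length + m ^ j * (αu ++ sigma m u ++ βu).length + sU.length = U.length := by
    rw [hUe]; simp [length_sigmaPow, add_assoc]
  have hlV : pV.length + m ^ j * (αv ++ sigma m v ++ βv).length + sV.length = U.length := by
    rw [hlen, hVe]; simp [length_sigmaPow, add_assoc]
  rw [hUb, hVb, ← hlen] at h
  obtain ⟨h1, h2, h3⟩ := parse_eq_of_binomEq hm j hi hpU hsU (by omega) hi' hpV hsV (by omega)
    hlU hlV h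
  rw [← hpUb, ← hpVb] at h1
  rw [← hsUb, ← hsVb] at h2
  rw [← hWU, ← hWV] at h3
  subst h1 h2
  have hs : ∀ β : List (ZMod m), β.length < m → (sigmaPow m j β ++ sU).length < m ^ (j + 1) := by
    intro β hβ
    rw [List.length_append, length_sigmaPow, add_comm]
    exact length_append_sigmaPow_lt hsU hβ
  have hp : ∀ α : List (ZMod m), α.length < m → (pU ++ sigmaPow m j α).length < m ^ (j + 1) := by
    intro α hα
    rw [List.length_append, length_sigmaPow]
    exact length_append_sigmaPow_lt hpU hα
  exact ⟨⟨hp _ hαu, hs _ hβu⟩, ⟨hp _ hαv, hs _ hβv⟩, pU, sU, αu, βu, αv, βv, hpU, hsU, rfl, rfl,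
    (perm_ends_iff (by omega) hαu hβu hαv hβv h3.length_eq).1 h3⟩

/-! ### Factorizations and part (2) -/

theorem exists_eq_append_sigmaPow_of_suffix {m : ℕ} (hm : 0 < m) (j : ℕ) {P w : List (ZMod m)}
    (h : P <:+ sigmaPow m j w) : ∃ p α, P = p ++ sigmaPow m j α ∧ p.length < m ^ j := by
  have hpos : 0 < m ^ j := pow_pos hm j
  have hl := h.length_le
  rw [length_sigmaPow] at hl
  have hdiv : P.length / m ^ j ≤ w.length := Nat.div_le_of_le_mul hl
  have hmod := Nat.mod_add_div P.length (m ^ j)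
  have hα : sigmaPow m j (w.drop (w.length - P.length / m ^ j)) <:+ sigmaPow m j w := by
    refine ⟨sigmaPow m j (w.take (w.length - P.length / m ^ j)), ?_⟩
    rw [← sigmaPow_append, List.take_append_drop]
  have hα' : (sigmaPow m j (w.drop (w.length - P.length / m ^ j))).length =
      m ^ j * (P.length / m ^ j) := by
    rw [length_sigmaPow, List.length_drop, Nat.sub_sub_self hdiv]
  obtain ⟨p, hp⟩ := List.suffix_of_suffix_length_le hα h (hα'.trans_le (Nat.mul_div_le _ _))
  refine ⟨p, _, hp.symm, ?_⟩
  have := congrArg List.length hp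
  rw [List.length_append, hα'] at this
  have := Nat.mod_lt P.length hpos
  omega

theorem exists_eq_sigmaPow_append_of_prefix {m : ℕ} (hm : 0 < m) (j : ℕ) {S w : List (ZMod m)}
    (h : S <+: sigmaPow m j w) : ∃ β s, S = sigmaPow m j β ++ s ∧ s.length < m ^ j := by
  have hpos : 0 < m ^ j := pow_pos hm j
  have hl := h.length_le
  rw [length_sigmaPow] at hl
  have hdiv : S.length / m ^ j ≤ w.length := Nat.div_le_of_le_mul hl
  have hmod := Nat.mod_add_div S.length (m ^ j)
  have hα : sigmaPow m j (w.take (S.length / m ^ j)) <+: sigmaPow m j w := by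
    refine ⟨sigmaPow m j (w.drop (S.length / m ^ j)), ?_⟩
    rw [← sigmaPow_append, List.take_append_drop]
  have hα' : (sigmaPow m j (w.take (S.length / m ^ j))).length = m ^ j * (S.length / m ^ j) := by
    rw [length_sigmaPow, List.length_take, min_eq_left hdiv]
  obtain ⟨s, hs⟩ := List.prefix_of_prefix_length_le hα h (hα'.trans_le (Nat.mul_div_le _ _))
  refine ⟨_, s, hs.symm, ?_⟩
  have := congrArg List.length hs
  rw [List.length_append, hα'] at this
  have := Nat.mod_lt S.length hpos
  omega

theorem length_lt_of_le_of_ne {m k : ℕ} (hm : 0 < m) {P a : List (ZMod m)} (ha : a.length ≤ 1)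
    (hle : P.length ≤ (sigmaPow m k a).length)
    (hne : P.length = (sigmaPow m k a).length → P = []) : P.length < m ^ k := by
  have hpos : 0 < m ^ k := pow_pos hm k
  rw [length_sigmaPow] at hle hne
  have h1 : m ^ k * a.length ≤ m ^ k * 1 := Nat.mul_le_mul_left _ ha
  rcases hle.lt_or_eq with h | h
  · omega
  · rw [hne h]; simpa using hpos

theorem length_lt_of_append_sigmaPow {m j : ℕ} {p α : List (ZMod m)}
    (h : (p ++ sigmaPow m j α).length < m ^ (j + 1)) : α.length < m := by
  rw [List.length_append, length_sigmaPow, pow_succ] at h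
  exact Nat.lt_of_mul_lt_mul_left (lt_of_le_of_lt (Nat.le_add_left _ _) h)

/-- The ends of a `σ_m^{j+1}`-factorization, cut along the blocks of `σ_m^j`. -/
theorem IsFactorization.exists_ends {m : ℕ} (hm : 0 < m) {j : ℕ} {U P u S : List (ZMod m)}
    (h : IsFactorization m (j + 1) U P u S) :
    ∃ p α β s, P = p ++ sigmaPow m j α ∧ S = sigmaPow m j β ++ s ∧ p.length < m ^ j ∧
      s.length < m ^ j ∧ α.length < m ∧ β.length < m := by
  obtain ⟨-, a, b, ha, hb, -, ⟨hP, hP'⟩, hS, hS'⟩ := h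
  have hPl := length_lt_of_le_of_ne hm ha hP.length_le fun h => hP' (hP.eq_of_length h)
  have hSl := length_lt_of_le_of_ne hm hb hS.length_le fun h => hS' (hS.eq_of_length h)
  rw [sigmaPow_succ'] at hP hS
  obtain ⟨p, α, rfl, hp⟩ := exists_eq_append_sigmaPow_of_suffix hm j hP
  obtain ⟨β, s, rfl, hs⟩ := exists_eq_sigmaPow_append_of_prefix hm j hS
  refine ⟨p, α, β, s, rfl, rfl, hp, hs, length_lt_of_append_sigmaPow hPl, ?_⟩
  rw [List.length_append, add_comm, ← List.length_append] at hSl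
  exact length_lt_of_append_sigmaPow hSl

/-- The outer words `x`, `y` are shared, and equal lengths make the middles abelian equivalent by
`perm_ends_iff`; applying `σ_m^j` raises this to order `j + 1`. -/
theorem PairEq.binomEq {m j : ℕ} (hm : 0 < m) {P u S Q v T : List (ZMod m)}
    (hlen : (P ++ sigmaPow m (j + 1) u ++ S).length = (Q ++ sigmaPow m (j + 1) v ++ T).length)
    (h : PairEq m (j + 1) (P, S) (Q, T)) :
    BinomEq (j + 1) (P ++ sigmaPow m (j + 1) u ++ S) (Q ++ sigmaPow m (j + 1) v ++ T) := by
  obtain ⟨⟨hP, hS⟩, ⟨hQ, hT⟩, x, y, p, q, r, t, -, -, h1, h2, h3⟩ := h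
  rw [Nat.add_sub_cancel, Prod.mk.injEq] at h1 h2
  obtain ⟨rfl, rfl⟩ := h1
  obtain ⟨rfl, rfl⟩ := h2
  have e : ∀ p u q : List (ZMod m),
      x ++ sigmaPow m j p ++ sigmaPow m (j + 1) u ++ (sigmaPow m j q ++ y) =
        x ++ sigmaPow m j (p ++ sigma m u ++ q) ++ y := by
    intro p u q
    simp only [sigmaPow_append, sigmaPow_succ', List.append_assoc]
  rw [e, e] at hlen ⊢
  have hl : (p ++ sigma m u ++ q).length = (r ++ sigma m v ++ t).length := by
    rw [List.length_append, List.length_append (bs := y), List.length_append,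
      List.length_append (as := x), length_sigmaPow, length_sigmaPow] at hlen
    exact Nat.eq_of_mul_eq_mul_left (pow_pos hm j) (by omega)
  have hq : ∀ q : List (ZMod m), (sigmaPow m j q ++ y).length < m ^ (j + 1) → q.length < m := by
    intro q h
    rw [List.length_append, add_comm, ← List.length_append] at h
    exact length_lt_of_append_sigmaPow h
  have hperm := (perm_ends_iff hm (length_lt_of_append_sigmaPow hP) (hq _ hS)
    (length_lt_of_append_sigmaPow hQ) (hq _ hT) hl).2 h3
  exact ((BinomEq.append fun _ _ => rfl) (hperm.binomEq_sigmaPow hm j)).append fun _ _ => rfl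

end ThueMorse

theorem mainTheorem9 (m k : ℕ) (hm : 2 ≤ m) (hk : 2 ≤ k) (U V : List (ZMod m))
    (hU : ThueMorse.IsFactor m U) (hV : ThueMorse.IsFactor m V)
    (hlen : U.length = V.length) (hlong : 2 * m ^ k ≤ U.length) :
    (∀ pU αu u βu sU pV αv v βv sV : List (ZMod m),
      U = pU ++ ThueMorse.sigmaPow m (k - 1) (αu ++ ThueMorse.sigma m u ++ βu) ++ sU →
      V = pV ++ ThueMorse.sigmaPow m (k - 1) (αv ++ ThueMorse.sigma m v ++ βv) ++ sV →
      pU.length < m ^ (k - 1) → sU.length < m ^ (k - 1) →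
      pV.length < m ^ (k - 1) → sV.length < m ^ (k - 1) →
      αu.length < m → βu.length < m → αv.length < m → βv.length < m →
      ThueMorse.BinomEq k U V →
      ThueMorse.PairEq m k
        (pU ++ ThueMorse.sigmaPow m (k - 1) αu, ThueMorse.sigmaPow m (k - 1) βu ++ sU)
        (pV ++ ThueMorse.sigmaPow m (k - 1) αv, ThueMorse.sigmaPow m (k - 1) βv ++ sV)) ∧
    (∀ PU u SU PV v SV : List (ZMod m),
      ThueMorse.IsFactorization m k U PU u SU →
      ThueMorse.IsFactorization m k V PV v SV →
      (ThueMorse.BinomEq k U V ↔ ThueMorse.PairEq m k (PU, SU) (PV, SV))) := by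
  obtain ⟨j, rfl⟩ : ∃ j, k = j + 1 := ⟨k - 1, by omega⟩
  rw [Nat.add_sub_cancel]
  refine ⟨fun pU αu u βu sU pV αv v βv sV hUe hVe hpU hsU hpV hsV hαu hβu hαv hβv h =>
    ThueMorse.pairEq_of_binomEq hm hU hV hlen hlong hUe hVe hpU hsU hpV hsV hαu hβu hαv hβv h,
    fun PU u SU PV v SV hFU hFV => ⟨fun h => ?_, fun h => ?_⟩⟩
  -- Since `σ_m^{j+1}(u) = σ_m^j(σ_m(u))`, cutting the ends along `σ_m^j` puts both words in the
  -- shape of part (1).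
  · obtain ⟨pU, αu, βu, sU, rfl, rfl, hpU, hsU, hαu, hβu⟩ := hFU.exists_ends (by omega)
    obtain ⟨pV, αv, βv, sV, rfl, rfl, hpV, hsV, hαv, hβv⟩ := hFV.exists_ends (by omega)
    refine ThueMorse.pairEq_of_binomEq hm hU hV hlen hlong (u := u) (v := v) ?_ ?_ hpU hsU hpV hsV
      hαu hβu hαv hβv h
    · rw [hFU.1]
      simp only [ThueMorse.sigmaPow_append, ThueMorse.sigmaPow_succ', List.append_assoc]
    · rw [hFV.1]
      simp only [ThueMorse.sigmaPow_append, ThueMorse.sigmaPow_succ', List.append_assoc]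
  · have hUe := hFU.1
    have hVe := hFV.1
    subst hUe hVe
    exact h.binomEq (by omega) hlen
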